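/- Let $n,m_1,m_2,s_1,s_2$ be nonnegative integers. For $u,v\in\mathbb{C}^n$ let $u\circledast v$ denote circular convolution, $(u\circledast v)_k=\sum_{j} u_j v_{k-j}$ with indices modulo $n$, and let $\|x\|_0$ be the number of nonzero entries of a vector $x$. Consider one of the following three scenarios for the constraint sets $\Omega_{\mathcal X}\subset\mathbb{C}^{m_1}$ and $\Omega_{\mathcal Y}\subset\mathbb{C}^{m_2}$ and the number $d$: (a) subspace constraints: $\Omega_{\mathcal X}=\mathbb{C}^{m_1}$, $\Omega_{\mathcal Y}=\mathbb{C}^{m_2}$, $d=m_1+m_2$; (b) mixed constraints: $\Omega_{\mathcal X}=\{x\in\mathbb{C}^{m_1}:\|x\|_0\le s_1\}$, $\Omega_{\mathcal Y}=\mathbb{C}^{m_2}$, $d=s_1+m_2$; (c) sparsity constraints: $\Omega_{\mathcal X}=\{x\in\mathbb{C}^{m_1}:\|x\|_0\le s_1\}$, $\Omega_{\mathcal Y}=\{y\in\mathbb{C}^{m_2}:\|y\|_0\le s_2\}$, $d=s_1+s_2$. For $D\in\mathbb{C}^{n\times m_1}$ and $E\in\mathbb{C}^{n\times m_2}$, a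 pair $(x_0,y_0)\in\Omega_{\mathcal X}\times\Omega_{\mathcal Y}$ with $x_0\ne0$ and $y_0\ne0$ is called identifiable up to scaling if every $(x,y)\in\Omega_{\mathcal X}\times\Omega_{\mathcal Y}$ with $(Dx)\circledast(Ey)=(Dx_0)\circledast(Ey_0)$ satisfies $x=\sigma x_0$ and $y=\frac1\sigma y_0$ for some nonzero $\sigma\in\mathbb{C}$. Let $\mathcal{G}_{DE}:\mathbb{C}^{m_1\times m_2}\to\mathbb{C}^n$ be the linear map determined by $\mathcal{G}_{DE}(xy^T)=(Dx)\circledast(Ey)$, and let $\Omega_{\mathcal M}=\{xy^T: x\in\Omega_{\mathcal X},\,y\in\Omega_{\mathcal Y}\}$. Suppose $n>2d$. Then for all pairs $(D,E)\in\mathbb{C}^{n\times m_1}\times\mathbb{C}^{n\times m_2}$ outside a set of Lebesgue measure zero, all pairs $(x_0,y_0)\in\Omega_{\mathcal X}\times\Omega_{\mathcal Y}$ with $x_0\ne0$ and $y_0\ne0$ are identifiable up to scaling. Equivalently, for all $(D,E)$ outside a set of Lebesgue measure zero, $\mathcal{G}_{DE}$ is injective on $\Omega_{\mathcal M}$; indeed,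 for every $(D,E)$ these two properties are equivalent. -/

import Mathlib

open MeasureTheory

namespace BlindDeconv

/-- Circular convolution on `ℂⁿ`: `(u ⊛ v)ₖ = ∑ⱼ uⱼ v₍ₖ₋ⱼ₎`, where the subtraction of indices in
`Fin n` is subtraction modulo `n`. -/
def circConv {n : ℕ} (u v : Fin n → ℂ) : Fin n → ℂ :=
  fun k => ∑ j, u j * v (k - j)

/-- The three constraint scenarios. In the mixed one the signal is sparse and the filter lies in
a subspace. -/
inductive Scenario : Type
  | subspace : Scenario
  | mixed (s₁ : ℕ) : Scenario
  | sparsity (s₁ s₂ : ℕ) : Scenario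

/-- The vectors of `ℂᵐ` with at most `s` nonzero entries. -/
def sparseVectors (m s : ℕ) : Set (Fin m → ℂ) := {x | hammingNorm x ≤ s}

/-- The constraint set for the coefficient vector of the signal. -/
def Scenario.signalSet (m₁ : ℕ) : Scenario → Set (Fin m₁ → ℂ)
  | .subspace => Set.univ
  | .mixed s₁ => sparseVectors m₁ s₁
  | .sparsity s₁ _ => sparseVectors m₁ s₁

/-- The constraint set for the coefficient vector of the filter. -/
def Scenario.filterSet (m₂ : ℕ) : Scenario → Set (Fin m₂ → ℂ)
  | .subspace => Set.univ
  | .mixed _ => Set.univ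
  | .sparsity _ s₂ => sparseVectors m₂ s₂

/-- The sample complexity bound `d`. -/
def Scenario.bound (m₁ m₂ : ℕ) : Scenario → ℕ
  | .subspace => m₁ + m₂
  | .mixed s₁ => s₁ + m₂
  | .sparsity s₁ s₂ => s₁ + s₂

/-- The pair `(x₀, y₀)` is identifiable up to scaling: every feasible `(x, y)` with
`(D x) ⊛ (E y) = (D x₀) ⊛ (E y₀)` is `(σ x₀, σ⁻¹ y₀)` for some nonzero scalar `σ`. -/
def IdentifiableUpToScaling {n m₁ m₂ : ℕ} (X : Set (Fin m₁ → ℂ)) (Y : Set (Fin m₂ → ℂ))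
    (D : Matrix (Fin n) (Fin m₁) ℂ) (E : Matrix (Fin n) (Fin m₂) ℂ)
    (x₀ : Fin m₁ → ℂ) (y₀ : Fin m₂ → ℂ) : Prop :=
  ∀ x ∈ X, ∀ y ∈ Y,
    circConv (D.mulVec x) (E.mulVec y) = circConv (D.mulVec x₀) (E.mulVec y₀) →
      ∃ σ : ℂ, σ ≠ 0 ∧ x = σ • x₀ ∧ y = σ⁻¹ • y₀

/-- Strong identifiability: every feasible pair with both entries nonzero is identifiable up to
scaling. -/
def StronglyIdentifiable {n m₁ m₂ : ℕ} (X : Set (Fin m₁ → ℂ)) (Y : Set (Fin m₂ → ℂ))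
    (D : Matrix (Fin n) (Fin m₁) ℂ) (E : Matrix (Fin n) (Fin m₂) ℂ) : Prop :=
  ∀ x₀ ∈ X, ∀ y₀ ∈ Y, x₀ ≠ 0 → y₀ ≠ 0 → IdentifiableUpToScaling X Y D E x₀ y₀

/-- The lifted constraint set `{x yᵀ : x ∈ X, y ∈ Y}`. -/
def liftedSet {m₁ m₂ : ℕ} (X : Set (Fin m₁ → ℂ)) (Y : Set (Fin m₂ → ℂ)) :
    Set (Matrix (Fin m₁) (Fin m₂) ℂ) :=
  {M | ∃ x ∈ X, ∃ y ∈ Y, M = Matrix.vecMulVec x y}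

/-- The lifted operator: the linear map with `x yᵀ ↦ (D x) ⊛ (E y)`, see
`liftedMap_vecMulVec` and `liftedMap_unique`. -/
def liftedMap {n m₁ m₂ : ℕ} (D : Matrix (Fin n) (Fin m₁) ℂ) (E : Matrix (Fin n) (Fin m₂) ℂ) :
    Matrix (Fin m₁) (Fin m₂) ℂ →ₗ[ℂ] (Fin n → ℂ) where
  toFun M := fun k => ∑ j, (D * M * E.transpose) j (k - j)
  map_add' M N := by
    funext k
    simp [Matrix.mul_add, Matrix.add_mul, Finset.sum_add_distrib]
  map_smul' c M := by
    funext k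
    simp [Finset.mul_sum]

theorem liftedMap_vecMulVec {n m₁ m₂ : ℕ} (D : Matrix (Fin n) (Fin m₁) ℂ)
    (E : Matrix (Fin n) (Fin m₂) ℂ) (x : Fin m₁ → ℂ) (y : Fin m₂ → ℂ) :
    liftedMap D E (Matrix.vecMulVec x y) = circConv (D.mulVec x) (E.mulVec y) := by
  funext k
  simp only [liftedMap, circConv, LinearMap.coe_mk, AddHom.coe_mk, Matrix.mul_vecMulVec,
    Matrix.vecMulVec_mul, Matrix.vecMulVec_apply, Matrix.vecMul_transpose]

theorem liftedMap_unique {n m₁ m₂ : ℕ} (D : Matrix (Fin n) (Fin m₁) ℂ)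
    (E : Matrix (Fin n) (Fin m₂) ℂ) (G : Matrix (Fin m₁) (Fin m₂) ℂ →ₗ[ℂ] (Fin n → ℂ))
    (hG : ∀ x y, G (Matrix.vecMulVec x y) = circConv (D.mulVec x) (E.mulVec y)) :
    G = liftedMap D E := by
  refine LinearMap.ext fun M => ?_
  rw [Matrix.matrix_eq_sum_single M]
  simp only [map_sum]
  refine Finset.sum_congr rfl fun i _ => Finset.sum_congr rfl fun j _ => ?_
  have h : Matrix.single i j (M i j) = Matrix.vecMulVec (Pi.single i (M i j)) (Pi.single j 1) := by
    ext a b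
    by_cases ha : i = a <;> by_cases hb : j = b <;>
      simp [Matrix.vecMulVec_apply, ha, hb, eq_comm]
  rw [h, hG, liftedMap_vecMulVec]

end BlindDeconv

/-!
For every `(D, E)`, identifiability and injectivity are equivalent because a nonzero matrix `x yᵀ`
determines `x` and `y` up to mutually inverse scalars (`stronglyIdentifiable_iff_injOn`).

Generic injectivity is a dimension count. The discrete Fourier transform `F` turns circular
convolution into an entrywise product, so that with `A = F D` and `B = F E` the `k`-th coordinate of
the transform of the lifted operator at `M` is `aₖᵀ M bₖ`, where `aₖ` and `bₖ` are the `k`-th rows of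
`A` and `B`. As `(D, E) ↦ (A, B)` is a linear automorphism, it is enough to treat almost all `(A, B)`.
Injectivity fails only if some `M = x yᵀ - x' y'ᵀ ≠ 0` with feasible `(x, y)` and `(x', y')` satisfies
`aₖᵀ M bₖ = 0` for all `k`. For given supports, `M` depends on at most `2 d` complex parameters, and
there are finitely many supports.

For `M ≠ 0`, each equation `aₖᵀ M bₖ = 0` expresses one of the coordinates of `(aₖ, bₖ)` as a rational
function of the parameters and the remaining coordinates: an entry of `aₖ` if `M bₖ ≠ 0`, and
otherwise an entry of `bₖ`. Thus `n` coordinates of `(A, B)` are eliminated at the price of `2 d < n`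
parameters, and the bad `(A, B)` lie in finitely many differentiable images of pieces of a proper
subspace. Such images are null sets (`volume_setOf_exists_forall_mem_eq_zero`).
-/

namespace BlindDeconv

/-! ### Diagonalization of circular convolution -/

/-- The discrete Fourier transform turns circular convolution into the entrywise product. -/
theorem exists_linearEquiv_circConv {n : ℕ} (hn : n ≠ 0) :
    ∃ F : (Fin n → ℂ) ≃ₗ[ℂ] (Fin n → ℂ), ∀ u v, F (circConv u v) = F u * F v := by
  obtain ⟨N, rfl⟩ := Nat.exists_eq_succ_of_ne_zero hn
  -- `Fin (N + 1)` and `ZMod (N + 1)` are the same type with the same subtraction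
  refine ⟨(ZMod.dft : (ZMod (N + 1) → ℂ) ≃ₗ[ℂ] (ZMod (N + 1) → ℂ)), fun u v => ?_⟩
  funext l
  have h : ∀ (u v : ZMod (N + 1) → ℂ) (l : ZMod (N + 1)),
      ZMod.dft (fun k => ∑ j, u j * v (k - j)) l = ZMod.dft u l * ZMod.dft v l := by
    intro u v l
    simp only [ZMod.dft_apply, smul_eq_mul, Finset.mul_sum, Finset.sum_mul]
    rw [Finset.sum_comm]
    conv_rhs => rw [Finset.sum_comm]
    refine Finset.sum_congr rfl fun j _ => ?_
    refine Fintype.sum_equiv (Equiv.subRight j) _ _ fun k => ?_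
    rw [Equiv.subRight_apply, show -(k * l) = -(j * l) + -((k - j) * l) by ring,
      AddChar.map_add_eq_mul]
    ring
  exact h u v l

/-! ### Identifiability and injectivity on the lifted set -/

theorem exists_smul_of_vecMulVec_eq {m₁ m₂ : ℕ} {x x₀ : Fin m₁ → ℂ} {y y₀ : Fin m₂ → ℂ}
    (hx₀ : x₀ ≠ 0) (hy₀ : y₀ ≠ 0) (h : Matrix.vecMulVec x y = Matrix.vecMulVec x₀ y₀) :
    ∃ σ : ℂ, σ ≠ 0 ∧ x = σ • x₀ ∧ y = σ⁻¹ • y₀ := by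
  obtain ⟨i, hi⟩ := Function.ne_iff.1 hx₀
  obtain ⟨j, hj⟩ := Function.ne_iff.1 hy₀
  simp only [Pi.zero_apply] at hi hj
  have h' : ∀ a b, x a * y b = x₀ a * y₀ b := fun a b => congrFun (congrFun h a) b
  have hij : x i * y j ≠ 0 := by rw [h']; exact mul_ne_zero hi hj
  have hxi := left_ne_zero_of_mul hij
  have hyj := right_ne_zero_of_mul hij
  refine ⟨x i / x₀ i, div_ne_zero hxi hi, ?_, ?_⟩
  · funext a
    rw [Pi.smul_apply, smul_eq_mul, div_mul_eq_mul_div, eq_div_iff hi]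
    refine mul_right_cancel₀ hyj ?_
    linear_combination x₀ i * h' a j - x₀ a * h' i j
  · funext b
    rw [Pi.smul_apply, smul_eq_mul, inv_div, div_mul_eq_mul_div, eq_div_iff hxi]
    linear_combination h' i b

theorem stronglyIdentifiable_iff_injOn {n m₁ m₂ : ℕ} (X : Set (Fin m₁ → ℂ))
    (Y : Set (Fin m₂ → ℂ)) (D : Matrix (Fin n) (Fin m₁) ℂ) (E : Matrix (Fin n) (Fin m₂) ℂ) :
    StronglyIdentifiable X Y D E ↔ Set.InjOn (liftedMap D E) (liftedSet X Y) := by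
  constructor
  · intro h
    -- Identifiability speaks only of nonzero reference pairs, so in the proof of injectivity either of
    -- the two matrices may have to take that role.
    have key : ∀ x ∈ X, ∀ y ∈ Y, ∀ x₀ ∈ X, ∀ y₀ ∈ Y,
        circConv (D.mulVec x) (E.mulVec y) = circConv (D.mulVec x₀) (E.mulVec y₀) →
        Matrix.vecMulVec x₀ y₀ ≠ 0 → Matrix.vecMulVec x y = Matrix.vecMulVec x₀ y₀ := by
      intro x hx y hy x₀ hx₀ y₀ hy₀ he h0
      have hx0 : x₀ ≠ 0 := by rintro rfl; exact h0 (by ext; simp [Matrix.vecMulVec_apply])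
      have hy0 : y₀ ≠ 0 := by rintro rfl; exact h0 (by ext; simp [Matrix.vecMulVec_apply])
      obtain ⟨σ, hσ, rfl, rfl⟩ := h x₀ hx₀ y₀ hy₀ hx0 hy0 x hx y hy he
      rw [Matrix.smul_vecMulVec, Matrix.vecMulVec_smul, smul_smul, mul_inv_cancel₀ hσ, one_smul]
    rintro _ ⟨x, hx, y, hy, rfl⟩ _ ⟨x', hx', y', hy', rfl⟩ he
    rw [liftedMap_vecMulVec, liftedMap_vecMulVec] at he
    by_cases h0 : Matrix.vecMulVec x' y' = 0
    · by_cases h1 : Matrix.vecMulVec x y = 0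
      · rw [h0, h1]
      · exact (key x' hx' y' hy' x hx y hy he.symm h1).symm
    · exact key x hx y hy x' hx' y' hy' he h0
  · intro h x₀ hx₀ y₀ hy₀ hx0 hy0 x hx y hy he
    refine exists_smul_of_vecMulVec_eq hx0 hy0 (h ⟨x, hx, y, hy, rfl⟩ ⟨x₀, hx₀, y₀, hy₀, rfl⟩ ?_)
    rw [liftedMap_vecMulVec, liftedMap_vecMulVec, he]

/-! ### Haar measures on spaces of complex matrices -/

/-- The general instance for the volume on a product is not found when the factors are products
themselves. -/
instance isAddHaarMeasure_volume_pi_pi {ι ι' : Type*} [Fintype ι] [Fintype ι'] :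
    (volume : Measure (ι → ι' → ℂ)).IsAddHaarMeasure :=
  Measure.pi.isAddHaarMeasure _

instance isAddHaarMeasure_volume_prod {ι ι₁ ι₂ : Type*} [Fintype ι] [Fintype ι₁] [Fintype ι₂] :
    (volume : Measure ((ι → ι₁ → ℂ) × (ι → ι₂ → ℂ))).IsAddHaarMeasure :=
  Measure.prod.instIsAddHaarMeasure _ _

/-! ### Elimination of one coordinate per row -/

/-- Suppose that at every point `(t, r)` of `Z` some coordinate `r (e c)` of the row `r` is a
differentiable function `φ c` of the parameters `t` and the other coordinates (with
`Function.update r (e c) 0` standing for the latter). Then, if there are fewer parameters than rows,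
almost no matrix `r` has all its rows related by `Z` to a common parameter vector.

For a fixed choice `c k` of charts, such a matrix is determined by `t` and the coordinates that are
not eliminated. The `n` eliminated slots have room for the `card κ < n` parameters and for one spare
coordinate set to `0`, so the matrices in question form a differentiable image of part of a
hyperplane. -/
theorem volume_setOf_exists_forall_mem_eq_zero {n : ℕ} {κ ρ C : Type*} [Fintype κ] [Fintype ρ]
    [DecidableEq ρ] [Finite C] (hκ : Fintype.card κ < n) (Z : Set ((κ → ℂ) × (ρ → ℂ)))
    (e : C → ρ) (φ : C → (κ → ℂ) × (ρ → ℂ) → ℂ)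
    (hZ : ∀ t r, (t, r) ∈ Z → ∃ c,
      DifferentiableAt ℂ (φ c) (t, Function.update r (e c) 0) ∧
        r (e c) = φ c (t, Function.update r (e c) 0)) :
    volume {r : Fin n → ρ → ℂ | ∃ t, ∀ k, (t, r k) ∈ Z} = 0 := by
  obtain ⟨emb⟩ : Nonempty (Option κ ↪ Fin n) :=
    Function.Embedding.nonempty_of_card_le (by simpa using hκ)
  -- the parameters stored in the slots that the chart choice `c` eliminates
  let T : (Fin n → C) → (Fin n → ρ → ℂ) → κ → ℂ :=
    fun c v j => v (emb (some j)) (e (c (emb (some j))))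
  -- the arguments of the `φ (c k)` that a matrix `v` with stored parameters encodes
  let G : (Fin n → C) → (Fin n → ρ → ℂ) → Fin n → (κ → ℂ) × (ρ → ℂ) :=
    fun c v k => (T c v, Function.update (v k) (e (c k)) 0)
  let F : (Fin n → C) → (Fin n → ρ → ℂ) → Fin n → ρ → ℂ :=
    fun c v k => Function.update (v k) (e (c k)) (φ (c k) (G c v k))
  -- the spare slot lies in the row `emb none`
  let H : (Fin n → C) → Set (Fin n → ρ → ℂ) :=
    fun c => {v | v (emb none) (e (c (emb none))) = 0}
  let U : (Fin n → C) → Set (Fin n → ρ → ℂ) :=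
    fun c => {v | ∀ k, DifferentiableAt ℂ (φ (c k)) (G c v k)}
  have hcover : {r : Fin n → ρ → ℂ | ∃ t, ∀ k, (t, r k) ∈ Z} ⊆ ⋃ c, F c '' (H c ∩ U c) := by
    rintro r ⟨t, ht⟩
    choose c hd hc using fun k => hZ t (r k) (ht k)
    -- `t` written into the slots of the rows in the range of `emb`, and `0` into the other slots
    let s : Fin n → ℂ := Function.extend emb (fun o => o.elim 0 t) 0
    have hs : ∀ o, s (emb o) = o.elim 0 t := fun o => emb.injective.extend_apply _ _ _
    let v : Fin n → ρ → ℂ := fun k => Function.update (r k) (e (c k)) (s k)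
    have hT : T c v = t := by
      funext j
      simp [T, v, hs]
    have hG : ∀ k, G c v k = (t, Function.update (r k) (e (c k)) 0) := fun k => by
      simp [G, hT, v]
    refine Set.mem_iUnion.2 ⟨c, v, ⟨by simp [H, v, hs], fun k => ?_⟩, ?_⟩
    · rw [hG]
      exact hd k
    · funext k
      simp only [F, hG, ← hc]
      simp [v]
  refine measure_mono_null hcover (measure_iUnion_null fun c => ?_)
  refine addHaar_image_eq_zero_of_differentiableOn_of_addHaar_eq_zero volume ?_ ?_
  · intro v hv
    have hG : ∀ k, DifferentiableAt ℂ (fun v => G c v k) v := by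
      intro k
      refine DifferentiableAt.prodMk ?_ ?_
      · simp only [T]; fun_prop
      · refine differentiableAt_pi.2 fun i => ?_
        by_cases hi : i = e (c k)
        · subst hi; simp
        · simp only [Function.update_of_ne hi]; fun_prop
    have hF : DifferentiableAt ℂ (F c) v := by
      refine differentiableAt_pi.2 fun k => differentiableAt_pi.2 fun i => ?_
      by_cases hi : i = e (c k)
      · subst hi
        simp only [F, Function.update_self]
        exact DifferentiableAt.comp (f := fun v => G c v k) v (hv.2 k) (hG k)
      · simp only [F, Function.update_of_ne hi]; fun_prop
    exact (hF.restrictScalars ℝ).differentiableWithinAt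
  · refine measure_mono_null Set.inter_subset_left ?_
    let L : (Fin n → ρ → ℂ) →ₗ[ℝ] ℂ :=
      { toFun := fun v => v (emb none) (e (c (emb none)))
        map_add' := fun _ _ => rfl
        map_smul' := fun _ _ => rfl }
    refine Measure.addHaar_submodule volume (LinearMap.ker L) fun h => ?_
    have : L (fun _ _ => 1) = 0 := LinearMap.mem_ker.1 (h ▸ Submodule.mem_top)
    simp [L] at this

theorem eq_neg_sum_mul_inv_of_sum_mul_eq_zero {ι : Type*} [Fintype ι] [DecidableEq ι]
    {a a' b : ι → ℂ} {i : ι} (h : ∑ j, a j * b j = 0) (hb : b i ≠ 0) (hi : a' i = 0)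
    (ha : ∀ j, j ≠ i → a' j = a j) : a i = -(∑ j, a' j * b j) * (b i)⁻¹ := by
  have h' : ∑ j ∈ Finset.univ.erase i, a' j * b j = ∑ j ∈ Finset.univ.erase i, a j * b j :=
    Finset.sum_congr rfl fun j hj => by rw [ha j (Finset.ne_of_mem_erase hj)]
  rw [← Finset.add_sum_erase _ _ (Finset.mem_univ i)] at h ⊢
  rw [← div_eq_mul_inv, eq_div_iff hb, h', hi]
  linear_combination h

/-- If `M t` is a matrix depending differentiably on fewer than `n` complex parameters, then for almost
all rows `(aₖ, bₖ)`, `k < n`, the equations `aₖᵀ M(t) bₖ = 0` for all `k` force `M t = 0`. -/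
theorem ae_forall_eq_zero_of_forall_dotProduct_mulVec_eq_zero {n : ℕ} {κ ι ι' : Type*} [Fintype κ]
    [Fintype ι] [Fintype ι'] (hκ : Fintype.card κ < n)
    (M : (κ → ℂ) → Matrix ι ι' ℂ) (hM : ∀ i j, Differentiable ℂ fun t => M t i j) :
    ∀ᵐ r : Fin n → ι ⊕ ι' → ℂ, ∀ t,
      (∀ k, (fun i => r k (.inl i)) ⬝ᵥ (M t).mulVec (fun j => r k (.inr j)) = 0) → M t = 0 := by
  classical
  let Z : Set ((κ → ℂ) × (ι ⊕ ι' → ℂ)) :=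
    {p | M p.1 ≠ 0 ∧ (fun i => p.2 (.inl i)) ⬝ᵥ (M p.1).mulVec (fun j => p.2 (.inr j)) = 0}
  -- the entry `(M b) i`
  let q : ι → (κ → ℂ) × (ι ⊕ ι' → ℂ) → ℂ :=
    fun i p => ∑ j, M p.1 i j * p.2 (.inr j)
  have hM' : ∀ i j, Differentiable ℂ fun p : (κ → ℂ) × (ι ⊕ ι' → ℂ) => M p.1 i j :=
    fun i j => (hM i j).comp differentiable_fst
  have hr : ∀ x, Differentiable ℂ fun p : (κ → ℂ) × (ι ⊕ ι' → ℂ) => p.2 x := fun x => by fun_prop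
  have hq : ∀ i, Differentiable ℂ (q i) := fun i =>
    Differentiable.fun_sum fun j _ => (hM' i j).mul (hr _)
  -- The chart `inl i` solves for the `i`-th entry of `a` where `(M b) i ≠ 0`. The chart `inr (i, j)` is
  -- used where `M b = 0`: it solves `(M b) i = 0` for the `j`-th entry of `b`, when `M i j ≠ 0`.
  let e : ι ⊕ ι × ι' → ι ⊕ ι' := Sum.map id Prod.snd
  let φ : ι ⊕ ι × ι' → (κ → ℂ) × (ι ⊕ ι' → ℂ) → ℂ := Sum.elim
    (fun i p => -(∑ i', p.2 (.inl i') * q i' p) * (q i p)⁻¹)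
    (fun ij p => -(∑ j, p.2 (.inr j) * M p.1 ij.1 j) * (M p.1 ij.1 ij.2)⁻¹)
  have key := volume_setOf_exists_forall_mem_eq_zero hκ Z e φ ?_
  · rw [ae_iff]
    refine measure_mono_null ?_ key
    intro r hr
    simp only [Set.mem_ofPred_eq, not_forall] at hr
    obtain ⟨t, h1, h2⟩ := hr
    exact ⟨t, fun k => ⟨h2, h1 k⟩⟩
  · rintro t r ⟨hMt, h0⟩
    by_cases h : ∃ i, q i (t, r) ≠ 0
    · obtain ⟨i, hi⟩ := h
      have hq' : ∀ i', q i' (t, Function.update r (.inl i) 0) = q i' (t, r) := fun i' => by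
        simp [q]
      refine ⟨.inl i, ?_, ?_⟩
      · refine DifferentiableAt.mul ?_ ((hq i _).inv (by simpa [e, hq'] using hi))
        exact (DifferentiableAt.fun_sum fun i' _ => (hr _ _).mul (hq i' _)).neg
      · have h0' : ∑ i', r (.inl i') * q i' (t, r) = 0 := h0
        simp only [e, φ, Sum.map_inl, id, Sum.elim_inl, hq']
        exact eq_neg_sum_mul_inv_of_sum_mul_eq_zero h0' hi (by simp)
          fun i' hi' => Function.update_of_ne (by simpa using hi') _ _
    · push Not at h
      obtain ⟨i, j, hij⟩ : ∃ i j, M t i j ≠ 0 := by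
        by_contra! h'
        exact hMt (Matrix.ext h')
      refine ⟨.inr (i, j), ?_, ?_⟩
      · refine DifferentiableAt.mul ?_ ((hM' i j _).inv hij)
        exact (DifferentiableAt.fun_sum fun j _ => (hr _ _).mul (hM' i j _)).neg
      · have h0' : ∑ j', r (.inr j') * M t i j' = 0 := by simpa only [mul_comm] using h i
        exact eq_neg_sum_mul_inv_of_sum_mul_eq_zero h0' hij (by simp [e])
          fun j' hj' => Function.update_of_ne (by simpa [e] using hj') _ _

/-! ### Sparse vectors as finitely many coordinate subspaces -/

/-- The vector of `ℂᵐ` with entries `t` on the finite set `I` and zeros elsewhere. -/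
def extendByZero {m : ℕ} (I : Finset (Fin m)) (t : I → ℂ) : Fin m → ℂ :=
  fun i => if h : i ∈ I then t ⟨i, h⟩ else 0

theorem differentiable_extendByZero {m : ℕ} {κ : Type*} [Fintype κ] (I : Finset (Fin m))
    (g : I → κ) (i : Fin m) :
    Differentiable ℂ fun t : κ → ℂ => extendByZero I (fun a => t (g a)) i := by
  unfold extendByZero
  split_ifs <;> fun_prop

theorem exists_extendByZero_eq {m s : ℕ} {x : Fin m → ℂ} (hx : x ∈ sparseVectors m s) :
    ∃ I : Finset (Fin m), I.card ≤ s ∧ extendByZero I (fun a => x a) = x := by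
  refine ⟨Finset.univ.filter fun i => x i ≠ 0, hx, ?_⟩
  funext i
  simp [extendByZero, eq_comm]

/-! ### Generic injectivity of the lifted operator -/

/-- Applying a linear automorphism `F` of `ℂⁿ` to all columns of `D` and `E` is an invertible change
of variables on the pairs `(D, E)`, returned here with the two new matrices side by side: row `k` of
the left block represents `x ↦ (F (D x))ₖ`, and likewise on the right. It is stated over `ℝ` because
it serves to transport null sets of Haar measures on real vector spaces. -/
theorem exists_linearEquiv_rows_of_linearEquiv {n m₁ m₂ : ℕ} (F : (Fin n → ℂ) ≃ₗ[ℂ] (Fin n → ℂ)) :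
    ∃ L : ((Fin n → Fin m₁ → ℂ) × (Fin n → Fin m₂ → ℂ)) ≃ₗ[ℝ] (Fin n → Fin m₁ ⊕ Fin m₂ → ℂ),
      (∀ DE x k, (fun i => L DE k (.inl i)) ⬝ᵥ x = F ((Matrix.of DE.1).mulVec x) k) ∧
      (∀ DE y k, (fun j => L DE k (.inr j)) ⬝ᵥ y = F ((Matrix.of DE.2).mulVec y) k) := by
  have hF : ∀ {m : ℕ} (D : Fin n → Fin m → ℂ) (x : Fin m → ℂ) k,
      (fun i => F (fun a => D a i) k) ⬝ᵥ x = F ((Matrix.of D).mulVec x) k := by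
    intro m D x k
    have : (Matrix.of D).mulVec x = ∑ i, x i • (fun a => D a i) := by
      funext a
      simp [Matrix.mulVec, dotProduct, mul_comm]
    rw [this, map_sum, Finset.sum_apply]
    simp [dotProduct, mul_comm]
  refine ⟨
    { toFun := fun DE k => Sum.elim (fun i => F (fun a => DE.1 a i) k)
        (fun j => F (fun a => DE.2 a j) k)
      invFun := fun r => (fun a i => F.symm (fun k => r k (.inl i)) a,
        fun a j => F.symm (fun k => r k (.inr j)) a)
      map_add' := ?_
      map_smul' := ?_
      left_inv := ?_
      right_inv := ?_ }, fun DE x k => hF DE.1 x k, fun DE y k => hF DE.2 y k⟩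
  · rintro ⟨D, E⟩ ⟨D', E'⟩
    funext k s
    cases s
    · exact congrFun (map_add F _ _) k
    · exact congrFun (map_add F _ _) k
  · rintro c ⟨D, E⟩
    funext k s
    cases s
    · exact congrFun ((F.restrictScalars ℝ).map_smul c _) k
    · exact congrFun ((F.restrictScalars ℝ).map_smul c _) k
  · rintro ⟨D, E⟩
    simp
  · intro r
    funext k s
    cases s <;> simp

/-- The difference of two feasible lifted matrices is `x yᵀ - x' y'ᵀ`, and for fixed supports the
nonzero entries of `x`, `y`, `x'`, `y'` are at most `2 (p + q) < n` complex parameters. -/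
theorem ae_injOn_liftedMap_sparseVectors {n m₁ m₂ p q : ℕ} (h : 2 * (p + q) < n) :
    ∀ᵐ DE : (Fin n → Fin m₁ → ℂ) × (Fin n → Fin m₂ → ℂ),
      Set.InjOn (liftedMap (Matrix.of DE.1) (Matrix.of DE.2))
        (liftedSet (sparseVectors m₁ p) (sparseVectors m₂ q)) := by
  obtain ⟨F, hF⟩ := exists_linearEquiv_circConv (n := n) (by omega)
  obtain ⟨L, hL₁, hL₂⟩ := exists_linearEquiv_rows_of_linearEquiv (m₁ := m₁) (m₂ := m₂) F
  have hLq : Measure.QuasiMeasurePreserving L volume volume := by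
    refine ⟨L.toContinuousLinearEquiv.continuous.measurable, ?_⟩
    have : (Measure.map L volume).IsAddHaarMeasure := L.toContinuousLinearEquiv.isAddHaarMeasure_map
      (volume : Measure ((Fin n → Fin m₁ → ℂ) × (Fin n → Fin m₂ → ℂ)))
    exact Measure.absolutelyContinuous_isAddHaarMeasure _ _
  let M : ∀ (I I' : Finset (Fin m₁)) (J J' : Finset (Fin m₂)),
      ((I ⊕ J) ⊕ (I' ⊕ J') → ℂ) → Matrix (Fin m₁) (Fin m₂) ℂ := fun I I' J J' t =>
    Matrix.vecMulVec (extendByZero I fun a => t (.inl (.inl a)))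
        (extendByZero J fun a => t (.inl (.inr a))) -
      Matrix.vecMulVec (extendByZero I' fun a => t (.inr (.inl a)))
        (extendByZero J' fun a => t (.inr (.inr a)))
  have hM : ∀ᵐ r : Fin n → Fin m₁ ⊕ Fin m₂ → ℂ, ∀ I I' J J',
      I.card ≤ p → I'.card ≤ p → J.card ≤ q → J'.card ≤ q → ∀ t,
        (∀ k, (fun i => r k (.inl i)) ⬝ᵥ (M I I' J J' t).mulVec (fun j => r k (.inr j)) = 0) →
          M I I' J J' t = 0 := by
    simp only [ae_all_iff]
    intro I I' J J' hI hI' hJ hJ'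
    refine ae_forall_eq_zero_of_forall_dotProduct_mulVec_eq_zero ?_ _ fun i j => ?_
    · simp only [Fintype.card_sum, Fintype.card_coe]
      omega
    · simp only [M, Matrix.sub_apply, Matrix.vecMulVec_apply]
      exact ((differentiable_extendByZero I _ i).mul (differentiable_extendByZero J _ j)).sub
        ((differentiable_extendByZero I' _ i).mul (differentiable_extendByZero J' _ j))
  filter_upwards [hLq.ae hM] with DE hDE
  rintro _ ⟨x, hx, y, hy, rfl⟩ _ ⟨x', hx', y', hy', rfl⟩ he
  rw [liftedMap_vecMulVec, liftedMap_vecMulVec] at he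
  -- the supports of the two feasible pairs select the matrix family, their entries the parameters
  obtain ⟨I, hI, hxI⟩ := exists_extendByZero_eq hx
  obtain ⟨I', hI', hxI'⟩ := exists_extendByZero_eq hx'
  obtain ⟨J, hJ, hyJ⟩ := exists_extendByZero_eq hy
  obtain ⟨J', hJ', hyJ'⟩ := exists_extendByZero_eq hy'
  have key := hDE I I' J J' hI hI' hJ hJ' (Sum.elim (Sum.elim (fun a => x a) fun a => y a)
    (Sum.elim (fun a => x' a) fun a => y' a))
  simp only [M, Sum.elim_inl, Sum.elim_inr, hxI, hxI', hyJ, hyJ'] at key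
  refine sub_eq_zero.1 (key fun k => ?_)
  have hk := congrFun (congrArg F he) k
  rw [hF, hF, Pi.mul_apply, Pi.mul_apply, ← hL₁, ← hL₁, ← hL₂, ← hL₂] at hk
  simp only [Matrix.sub_mulVec, Matrix.vecMulVec_mulVec, dotProduct_sub, dotProduct_smul]
  rw [sub_eq_zero, dotProduct_comm y, dotProduct_comm y']
  simpa [mul_comm] using hk

/-- A subspace constraint on `ℂᵐ` is the sparsity constraint at level `m`, so that all three scenarios
are special cases of the doubly sparse one with the same `d`. -/
theorem Scenario.exists_subset_sparseVectors (m₁ m₂ : ℕ) (S : Scenario) :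
    ∃ p q, p + q = S.bound m₁ m₂ ∧ S.signalSet m₁ ⊆ sparseVectors m₁ p ∧
      S.filterSet m₂ ⊆ sparseVectors m₂ q := by
  have huniv : ∀ m, Set.univ ⊆ sparseVectors m m := fun m x _ => by
    simpa [sparseVectors] using hammingNorm_le_card_fintype (x := x)
  cases S with
  | subspace => exact ⟨m₁, m₂, rfl, huniv m₁, huniv m₂⟩
  | mixed s₁ => exact ⟨s₁, m₂, rfl, subset_rfl, huniv m₂⟩
  | sparsity s₁ s₂ => exact ⟨s₁, s₂, rfl, subset_rfl, subset_rfl⟩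

theorem liftedSet_mono {m₁ m₂ : ℕ} {X X' : Set (Fin m₁ → ℂ)} {Y Y' : Set (Fin m₂ → ℂ)}
    (hX : X ⊆ X') (hY : Y ⊆ Y') : liftedSet X Y ⊆ liftedSet X' Y' := by
  rintro _ ⟨x, hx, y, hy, rfl⟩
  exact ⟨x, hX hx, y, hY hy, rfl⟩

end BlindDeconv

theorem theorem2 (n m₁ m₂ : ℕ) (S : BlindDeconv.Scenario) (hn : 2 * S.bound m₁ m₂ < n) :
    (∀ᵐ DE : (Fin n → Fin m₁ → ℂ) × (Fin n → Fin m₂ → ℂ)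
        ∂(volume : Measure ((Fin n → Fin m₁ → ℂ) × (Fin n → Fin m₂ → ℂ))),
      BlindDeconv.StronglyIdentifiable (S.signalSet m₁) (S.filterSet m₂)
          (Matrix.of DE.1) (Matrix.of DE.2) ∧
        Set.InjOn (BlindDeconv.liftedMap (Matrix.of DE.1) (Matrix.of DE.2))
          (BlindDeconv.liftedSet (S.signalSet m₁) (S.filterSet m₂))) ∧
    ∀ (D : Matrix (Fin n) (Fin m₁) ℂ) (E : Matrix (Fin n) (Fin m₂) ℂ),
      BlindDeconv.StronglyIdentifiable (S.signalSet m₁) (S.filterSet m₂) D E ↔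
        Set.InjOn (BlindDeconv.liftedMap D E)
          (BlindDeconv.liftedSet (S.signalSet m₁) (S.filterSet m₂)) := by
  refine ⟨?_, BlindDeconv.stronglyIdentifiable_iff_injOn _ _⟩
  obtain ⟨p, q, hpq, hX, hY⟩ := S.exists_subset_sparseVectors m₁ m₂
  filter_upwards [BlindDeconv.ae_injOn_liftedMap_sparseVectors (hpq ▸ hn)] with DE hDE
  have hinj := hDE.mono (BlindDeconv.liftedSet_mono hX hY)
  exact ⟨(BlindDeconv.stronglyIdentifiable_iff_injOn _ _ _ _).2 hinj, hinj⟩
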